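/- Write $\mathbb{N}=\{1,2,\dots\}$, let $[M]$ and $[M]^{<\mathbb{N}}$ denote the sets of infinite, resp. finite, subsets of $M\subseteq\mathbb{N}$, and list sets of natural numbers in increasing order. For nonempty $E,F$, $E<F$ means $\max E<\min F$, and $n\le E$ means $n\le \min E$ (both hold if a set involved is empty). **Families.** A family $\mathcal{G}\subseteq[\mathbb{N}]^{<\mathbb{N}}$ is *regular* if it is compact in the Cantor space $2^{\mathbb{N}}$, hereditary ($E\subseteq F\in\mathcal{G}$ implies $E\in\mathcal{G}$) and spreading ($\{m_1<\dots<m_r\}\in\mathcal{G}$ and $m_i\le n_i$ for all $i$, $n_1<\dots<n_r$, imply $\{n_1,\dots,n_r\}\in\mathcal{G}$). $MAX(\mathcal{G})$ is the set of its inclusion-maximal members, and $CB(\mathcal{G})$ is its Cantor–Bendixson index, the least $\eta$ such that the $\eta$-th Cantor–Bendixson derivative is empty. $\mathcal{G}$ is *nice* if it is regular, $\{1\}\in\mathcal{G}$, and every nonempty $E\in\mathcal{G}$ satisfies $E\in MAX(\mathcal{G})$ or $E\cup\{1+\max E\}\in\mathcal{G}$. If $\mathcal{P}$ is nice, every $M\in[\mathbb{N}]$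 has a unique nonempty initial segment $M_{\mathcal{P}}$ lying in $MAX(\mathcal{P})$. **Schreier families.** $\mathcal{S}_0=\{E:|E|\le1\}$; $\mathcal{S}_{\xi+1}$ consists of $\varnothing$ and all unions $\bigcup_{i=1}^nE_i$ with $n\in\mathbb{N}$, $\varnothing\ne E_i\in\mathcal{S}_\xi$, $n\le E_1$, $E_1<\dots<E_n$; for a countable limit ordinal $\xi$, $\mathcal{S}_\xi=\{E: \exists n\le E,\ E\in\mathcal{S}_{\xi_n+1}\}$, where $(\xi_n)_{n\ge1}$ is a chosen strictly increasing sequence of ordinals below $\xi$ with supremum $\xi$. The result holds for every such choice. For $M=\{m_1<m_2<\dots\}$ put $\mathcal{S}_\xi(M)=\{\{m_n:n\in E\}:E\in\mathcal{S}_\xi\}$. **Probability blocks.** Let $\mathcal{P}$ be nice and $\mathfrak{P}=\{\mathbb{P}_{M,n}:M\in[\mathbb{N}],n\in\mathbb{N}\}$ a family of probability measures on $\mathbb{N}$. The pair $(\mathfrak{P},\mathcal{P})$ is a *probability block* if (i) $\mathbb{P}_{N,1}=\mathbb{P}_{M,r}$ whenever $M\in[\mathbb{N}]$, $r\in\mathbb{N}$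 and $N=M\setminus\bigcup_{i<r}\operatorname{supp}\mathbb{P}_{M,i}$, and (ii) $\operatorname{supp}\mathbb{P}_{M,1}=M_{\mathcal{P}}$ for all $M\in[\mathbb{N}]$. It is *$\xi$-sufficient* if for every $\varepsilon>0$, every regular $\mathcal{G}$ with $CB(\mathcal{G})\le\omega^\xi$ and every $L\in[\mathbb{N}]$ there is $M\in[L]$ such that $\mathbb{P}_{N,1}(E)\le\varepsilon$ for all $N\in[M]$ and $E\in\mathcal{G}$. **Theorem.** Let $\xi$ be a countable ordinal. Then every $\xi$-sufficient probability block $(\mathfrak{P},\mathcal{P})$ is *$\xi$-regulatory*, that is: for every bounded $f:\mathbb{N}\times MAX(\mathcal{P})\to\mathbb{R}$, all real $\delta<\varepsilon$ and every $L\in[\mathbb{N}]$ such that $$\sum_{i=1}^\infty\mathbb{P}_{M,1}(i)\,f(i,\operatorname{supp}\mathbb{P}_{M,1})\ge\varepsilon\qquad\text{for all }M\in[L],$$ there is $M\in[\mathbb{N}]$ such that $$\mathcal{S}_\xi(M)\subseteq\{E\in[L]^{<\mathbb{N}}:\ \exists F\in MAX(\mathcal{P})\cap[L]^{<\mathbb{N}}\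 \ \forall i\in E\ \ f(i,F)\ge\delta\}.$$ -/

import Mathlib

namespace ProbBlock

open scoped Ordinal

/-! Throughout, the natural numbers start at `1`, so they are modelled by `ℕ+`; a family of finite
sets of natural numbers is a `Set (Finset ℕ+)`. -/

/-- The infinite subsets of the natural numbers. -/
abbrev InfSubset : Type := {M : Set ℕ+ // M.Infinite}

/-! ### Families of finite sets -/

/-- `F` is a spread of `E`: both have the same number `r` of elements, and the `i`-th element of
`E` is at most the `i`-th element of `F`, for each `i`. -/
def IsSpread (F E : Finset ℕ+) : Prop :=
  ∃ h : F.card = E.card, ∀ i : Fin E.card, E.orderEmbOfFin rfl i ≤ F.orderEmbOfFin h i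

/-- A finite set as a point of the Cantor space. -/
def toCantor (E : Finset ℕ+) : ℕ+ → Bool := fun n => decide (n ∈ E)

/-- A family of finite sets as a subset of the Cantor space. -/
def cantorImage (G : Set (Finset ℕ+)) : Set (ℕ+ → Bool) := toCantor '' G

def IsHereditary (G : Set (Finset ℕ+)) : Prop := ∀ F ∈ G, ∀ E, E ⊆ F → E ∈ G

def IsSpreading (G : Set (Finset ℕ+)) : Prop := ∀ E ∈ G, ∀ F, IsSpread F E → F ∈ G

/-- Regular families: compact in the Cantor topology, hereditary and spreading. -/
structure IsRegular (G : Set (Finset ℕ+)) : Prop where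
  compact : IsCompact (cantorImage G)
  hereditary : IsHereditary G
  spreading : IsSpreading G

/-- The family `MAX(G)` of the members of `G` that are maximal with respect to inclusion. -/
def maxMembers (G : Set (Finset ℕ+)) : Set (Finset ℕ+) := {E | Maximal (· ∈ G) E}

structure IsNice (G : Set (Finset ℕ+)) : Prop where
  regular : IsRegular G
  one_mem : {1} ∈ G
  max_or_insert : ∀ E ∈ G, ∀ h : E.Nonempty, E ∈ maxMembers G ∨ insert (E.max' h + 1) E ∈ G

/-- The Cantor–Bendixson index of a family, with the relative topology of the Cantor space: the
least `η` such that the `η`-th derivative is empty, and `⊤` if there is none. -/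
noncomputable def cbIndex (G : Set (Finset ℕ+)) : WithTop Ordinal.{0} :=
  open Classical in
  if ∃ η : Ordinal.{0}, CantorBendixson.iteratedDerivedSet (cantorImage G) η = ∅ then
    ((sInf {η : Ordinal.{0} | CantorBendixson.iteratedDerivedSet (cantorImage G) η = ∅} :
      Ordinal.{0}) : WithTop Ordinal.{0})
  else ⊤

/-! ### Schreier families -/

/-- `c` assigns to each countable limit ordinal `ξ` a sequence of smaller ordinals that increases
to `ξ`. -/
def IsFundamentalChoice (c : Ordinal.{0} → ℕ+ → Ordinal.{0}) : Prop :=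
  ∀ ξ : Ordinal.{0}, ξ < ω₁ → Order.IsSuccLimit ξ →
    StrictMono (c ξ) ∧ (∀ n, c ξ n < ξ) ∧ ∀ ζ < ξ, ∃ n, ζ < c ξ n

/-- The sets `∅` and `E₁ ∪ ⋯ ∪ Eₙ` with nonempty `Eᵢ ∈ S`, `n ≤ E₁` and `E₁ < ⋯ < Eₙ`. -/
def schreierSucc (S : Set (Finset ℕ+)) : Set (Finset ℕ+) :=
  {∅} ∪ {E | ∃ (n : ℕ+) (F : Fin n → Finset ℕ+),
    (∀ i, (F i).Nonempty ∧ F i ∈ S) ∧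
    (∀ i, ∀ a ∈ F i, n ≤ a) ∧
    (∀ i j, i < j → ∀ a ∈ F i, ∀ b ∈ F j, a < b) ∧
    E = Finset.univ.biUnion F}

/-- The Schreier families `S_ξ`, built with the sequences `c ξ` at limit stages. If `c` is a
fundamental choice, then the condition `c ξ n + 1 < ξ` below holds for every `n`. -/
noncomputable def schreier (c : Ordinal.{0} → ℕ+ → Ordinal.{0}) (ξ : Ordinal.{0}) :
    Set (Finset ℕ+) :=
  Ordinal.limitRecOn ξ
    {E | E.card ≤ 1}
    (fun _ S => schreierSucc S)
    (fun ξ _ S => {E | ∃ n : ℕ+, (∀ a ∈ E, n ≤ a) ∧ ∃ h : c ξ n + 1 < ξ, E ∈ S (c ξ n + 1) h})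

/-- `S_ξ(M) ⊆ 𝔈` for some infinite `M = {m 1 < m 2 < ⋯}`, where
`S_ξ(M) = {{m n | n ∈ E} | E ∈ S_ξ}`. -/
def IsFull (c : Ordinal.{0} → ℕ+ → Ordinal.{0}) (ξ : Ordinal.{0}) (𝔈 : Set (Finset ℕ+)) : Prop :=
  ∃ m : ℕ+ ↪o ℕ+, ∀ E ∈ schreier c ξ, E.map m.toEmbedding ∈ 𝔈

/-! ### Probability blocks -/

/-- `F` is a nonempty initial segment of `M`. -/
def IsInitialSegment (F : Finset ℕ+) (M : Set ℕ+) : Prop :=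
  F.Nonempty ∧ (F : Set ℕ+) ⊆ M ∧ ∀ a ∈ M, ∀ b ∈ F, a ≤ b → a ∈ F

/-- The probability measures `P M n` and the nice family `𝒬` form a probability block. In
`support_one`, `F` is the unique nonempty initial segment of `M` that lies in `MAX(𝒬)`. -/
structure IsProbabilityBlock (P : InfSubset → ℕ+ → PMF ℕ+) (𝒬 : Set (Finset ℕ+)) : Prop where
  nice : IsNice 𝒬
  shift : ∀ (M N : InfSubset) (r : ℕ+),
    (N : Set ℕ+) = (M : Set ℕ+) \ ⋃ i : ℕ+, ⋃ _ : i < r, (P M i).support → P N 1 = P M r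
  support_one : ∀ M : InfSubset, ∃ F ∈ maxMembers 𝒬, IsInitialSegment F (M : Set ℕ+) ∧
    (P M 1).support = (F : Set ℕ+)

/-- `ξ`-sufficiency: for every `ε > 0`, every regular `G` of Cantor–Bendixson index at most `ω ^ ξ`
and every infinite `L` there is an infinite `M ⊆ L` such that `P N 1 (E) ≤ ε` for all infinite
`N ⊆ M` and all `E ∈ G`. -/
def IsSufficient (P : InfSubset → ℕ+ → PMF ℕ+) (ξ : Ordinal.{0}) : Prop :=
  ∀ ε : ℝ, 0 < ε → ∀ G : Set (Finset ℕ+), IsRegular G →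
    cbIndex G ≤ ((ω ^ ξ : Ordinal.{0}) : WithTop Ordinal.{0}) →
    ∀ L : InfSubset, ∃ M : InfSubset, (M : Set ℕ+) ⊆ L ∧
      ∀ N : InfSubset, (N : Set ℕ+) ⊆ M → ∀ E ∈ G, ∑ i ∈ E, (P N 1 i).toReal ≤ ε

/-- The infinite sets `M` with `∑ i, P M 1 (i) * f (i, supp (P M 1)) ≥ ε`; for a probability block,
`supp (P M 1)` belongs to `MAX(𝒬)`. -/
def largeAverage (P : InfSubset → ℕ+ → PMF ℕ+) (𝒬 : Set (Finset ℕ+)) (f : ℕ+ → maxMembers 𝒬 → ℝ)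
    (ε : ℝ) : Set InfSubset :=
  {M | ∃ F : maxMembers 𝒬, (P M 1).support = ((F : Finset ℕ+) : Set ℕ+) ∧
    ε ≤ ∑' i : ℕ+, (P M 1 i).toReal * f i F}

/-- The finite sets `E ⊆ M` for which there is `F ∈ MAX(𝒬)`, `F ⊆ M`, with `f (i, F) ≥ ε` for all
`i ∈ E`. -/
def largeSets (𝒬 : Set (Finset ℕ+)) (f : ℕ+ → maxMembers 𝒬 → ℝ) (M : InfSubset) (ε : ℝ) :
    Set (Finset ℕ+) :=
  {E | (E : Set ℕ+) ⊆ M ∧ ∃ F : maxMembers 𝒬, ((F : Finset ℕ+) : Set ℕ+) ⊆ M ∧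
    ∀ i ∈ E, ε ≤ f i F}

/-- `ξ`-regulatory: for every bounded `f : ℕ × MAX(𝒬) → ℝ` and all `δ < ε`, if every infinite
subset of `L` has average at least `ε`, then `largeSets 𝒬 f L δ` is `ξ`-full. -/
def IsRegulatory (c : Ordinal.{0} → ℕ+ → Ordinal.{0}) (P : InfSubset → ℕ+ → PMF ℕ+)
    (𝒬 : Set (Finset ℕ+)) (ξ : Ordinal.{0}) : Prop :=
  ∀ f : ℕ+ → maxMembers 𝒬 → ℝ, (∃ C : ℝ, ∀ i F, |f i F| ≤ C) →
    ∀ δ ε : ℝ, δ < ε → ∀ L : InfSubset,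
      (∀ M : InfSubset, (M : Set ℕ+) ⊆ L → M ∈ largeAverage P 𝒬 f ε) →
      IsFull c ξ (largeSets 𝒬 f L δ)

end ProbBlock

namespace ProbBlock

open scoped Ordinal
open Set Topology CantorBendixson

/-! ### Cantor–Bendixson derivatives -/

section Derivative

universe u

variable {X Y : Type u} [TopologicalSpace X] [TopologicalSpace Y]

/-! Sufficiency cannot be applied to `S_ξ` itself, since its derivative of order `ω ^ ξ` may still
contain `∅`. For `ξ ≠ 0`, however, `S_ξ` is a diagonal union of regular families `H n` whose
derivatives of that order are empty (`schreier_eq_diagonalUnion`), and sufficiency applies to each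
of them.

Fix `n`. By `hereditary_dichotomy`, a consequence of Galvin's lemma, every infinite subset of `L`
contains an infinite `M` on which either `H n` lies in the family of large sets, or the large sets
lie in `H n`. The second case is impossible: an average of at least `ε > δ` of a bounded function
yields, inside every infinite `N ⊆ M`, a large set whose `P N 1`-mass is bounded below, whereas
sufficiency makes all members of `H n` arbitrarily light for some `N`
(`exists_mem_largeSets_notMem`). So the first case always holds, and a diagonal sequence through the
sets obtained for successive `n`, together with spreading, gives the copy of `S_ξ`
(`exists_map_mem_of_diagonalUnion`).

The index bounds rest on two facts: ranks add under joins, and near a nonempty set only finitely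
many pieces of a diagonal union matter. The case `ξ = 0` needs only that large sets are nonempty and
hereditary. -/

theorem iteratedDerivedSet_subset (A : Set X) (α : Ordinal) : iteratedDerivedSet A α ⊆ A := by
  simpa using iteratedDerivedSet_antitone A (zero_le (a := α))

/-- A continuous map that is injective on an open set is compatible with derivatives there. -/
theorem mapsTo_iteratedDerivedSet {g : X → Y} (hg : Continuous g) {S : Set X} (hS : IsOpen S)
    (hinj : InjOn g S) {A : Set X} {B : Set Y} (hAB : MapsTo g (A ∩ S) B) (α : Ordinal) :
    MapsTo g (iteratedDerivedSet A α ∩ S) (iteratedDerivedSet B α) := by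
  induction α using Ordinal.limitRecOn with
  | zero => simpa using hAB
  | add_one α ih =>
    rintro x ⟨hx, hxS⟩
    rw [iteratedDerivedSet_succ] at hx ⊢
    refine ⟨?_, ih ⟨hx.2, hxS⟩⟩
    have h1 := hx.1
    rw [mem_derivedSet, accPt_iff_nhds] at h1 ⊢
    intro U hU
    obtain ⟨y, ⟨⟨hyU, hyS⟩, hyA⟩, hyx⟩ :=
      h1 (g ⁻¹' U ∩ S) (Filter.inter_mem (hg.continuousAt hU) (hS.mem_nhds hxS))
    exact ⟨g y, ⟨hyU, ih ⟨hyA, hyS⟩⟩, fun h => hyx (hinj hyS hxS h)⟩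
  | limit α hα ih =>
    rintro x ⟨hx, hxS⟩
    rw [iteratedDerivedSet_limit hα, mem_iInter] at hx ⊢
    exact fun b => ih b b.2 ⟨hx b, hxS⟩

theorem mem_iteratedDerivedSet_inter {A S : Set X} (hS : IsOpen S) {x : X} {α : Ordinal}
    (hx : x ∈ iteratedDerivedSet A α) (hxS : x ∈ S) : x ∈ iteratedDerivedSet (A ∩ S) α :=
  mapsTo_iteratedDerivedSet continuous_id hS (injOn_id S) (mapsTo_id _) α ⟨hx, hxS⟩

/-- For closed sets the relative derivative is the derived set, which commutes with finite unions.
At a limit, stages at which a point has left each part are merged into their maximum. -/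
theorem iteratedDerivedSet_union_subset {A B : Set X} (hA : IsClosed A) (hB : IsClosed B)
    (α : Ordinal) :
    iteratedDerivedSet (A ∪ B) α ⊆ iteratedDerivedSet A α ∪ iteratedDerivedSet B α := by
  induction α using Ordinal.limitRecOn with
  | zero => simp
  | add_one α ih =>
    simp only [iteratedDerivedSet_succ]
    rw [(isClosed_iteratedDerivedSet hA α).relDerivedSet_eq,
      (isClosed_iteratedDerivedSet hB α).relDerivedSet_eq,
      (isClosed_iteratedDerivedSet (hA.union hB) α).relDerivedSet_eq, ← derivedSet_union]
    exact derivedSet_mono _ _ ih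
  | limit α hα ih =>
    intro x hx
    by_contra hcon
    simp only [iteratedDerivedSet_limit hα, mem_union, mem_iInter, not_or, not_forall] at hcon hx
    obtain ⟨⟨b, hb⟩, ⟨c, hc⟩⟩ := hcon
    have hbc : max b.1 c.1 < α := max_lt b.2 c.2
    rcases ih _ hbc (hx ⟨_, hbc⟩) with h | h
    · exact hb (iteratedDerivedSet_antitone A (le_max_left _ _) h)
    · exact hc (iteratedDerivedSet_antitone B (le_max_right _ _) h)

@[simp]
theorem iteratedDerivedSet_empty (α : Ordinal) : iteratedDerivedSet (∅ : Set X) α = ∅ :=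
  subset_empty_iff.1 (iteratedDerivedSet_subset _ _)

theorem iteratedDerivedSet_biUnion_subset {ι : Type*} (s : Finset ι) {A : ι → Set X}
    (hA : ∀ i ∈ s, IsClosed (A i)) (α : Ordinal) :
    iteratedDerivedSet (⋃ i ∈ s, A i) α ⊆ ⋃ i ∈ s, iteratedDerivedSet (A i) α := by
  classical
  induction s using Finset.induction_on with
  | empty => simp
  | insert a s ha ih =>
    rw [Finset.set_biUnion_insert, Finset.set_biUnion_insert]
    refine (iteratedDerivedSet_union_subset (hA a (Finset.mem_insert_self _ _))
      (isClosed_biUnion_finset fun i hi => hA i (Finset.mem_insert_of_mem hi)) α).trans ?_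
    exact union_subset_union_right _ (ih fun i hi => hA i (Finset.mem_insert_of_mem hi))

theorem iteratedDerivedSet_add_subset (A : Set X) (α β : Ordinal) :
    iteratedDerivedSet A (α + β) ⊆ iteratedDerivedSet (iteratedDerivedSet A α) β := by
  induction β using Ordinal.limitRecOn with
  | zero => simp
  | add_one β ih =>
    rw [← add_assoc, iteratedDerivedSet_succ, iteratedDerivedSet_succ]
    exact relDerivedSet.monotone ih
  | limit β hβ ih =>
    intro x hx
    rw [iteratedDerivedSet_limit hβ, mem_iInter]
    exact fun b => ih b b.2 (iteratedDerivedSet_antitone A (by gcongr; exact b.2.le) hx)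

theorem iteratedDerivedSet_one_of_subset_singleton {A : Set X} {p : X} (h : A ⊆ {p}) :
    iteratedDerivedSet A 1 = ∅ := by
  rw [← zero_add (1 : Ordinal), iteratedDerivedSet_succ, iteratedDerivedSet_zero]
  refine eq_empty_of_forall_notMem fun x hx => ?_
  have h1 := hx.1
  rw [mem_derivedSet, accPt_iff_nhds] at h1
  obtain ⟨y, hy, hyx⟩ := h1 univ Filter.univ_mem
  exact hyx ((h hy.2).trans (h hx.2).symm)

end Derivative

/-! ### Galvin's lemma -/

/-- `F` is a possibly empty initial segment of `N`. -/
def IsInitial (F : Finset ℕ+) (N : Set ℕ+) : Prop :=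
  (F : Set ℕ+) ⊆ N ∧ ∀ a ∈ N, ∀ b ∈ F, a ≤ b → a ∈ F

/-- `N` takes its steps beyond `s` in the sets prescribed by `V`. -/
def IsDiagonal (V : Finset ℕ+ → Set ℕ+) (s : Finset ℕ+) (N : Set ℕ+) : Prop :=
  ∀ t : Finset ℕ+, s ⊆ t → (t : Set ℕ+) ⊆ N → ∀ n ∈ N, (∀ a ∈ t, a < n) → n ∈ V t

/-- For some choice of steps large with respect to `𝓤`, every infinite set that begins with `s` and
takes these steps has an initial segment in `𝓕`. -/
def LeadsTo (𝓤 : Ultrafilter ℕ+) (𝓕 : Set (Finset ℕ+)) (s : Finset ℕ+) : Prop :=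
  ∃ V : Finset ℕ+ → Set ℕ+, (∀ t, V t ∈ 𝓤) ∧ ∀ N : Set ℕ+, N.Infinite → IsInitial s N →
    IsDiagonal V s N → ∃ F ∈ 𝓕, IsInitial F N

theorem leadsTo_of_mem {𝓤 : Ultrafilter ℕ+} {𝓕 : Set (Finset ℕ+)} {s : Finset ℕ+} (hs : s ∈ 𝓕) :
    LeadsTo 𝓤 𝓕 s :=
  ⟨fun _ => univ, fun _ => Filter.univ_mem, fun _ _ h _ => ⟨s, hs, h⟩⟩

/-- The least element of `N` outside an initial segment. -/
theorem IsInitial.exists_next {s : Finset ℕ+} {N : Set ℕ+} (hs : IsInitial s N)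
    (hN : N.Infinite) : ∃ n ∈ N, (∀ a ∈ s, a < n) ∧ IsInitial (insert n s) N := by
  have hne : (N \ s).Nonempty := (hN.sdiff s.finite_toSet).nonempty
  obtain ⟨n, ⟨hnN, hns⟩, hmin⟩ := WellFounded.has_min (wellFounded_lt (α := ℕ+)) _ hne
  refine ⟨n, hnN, fun a ha => ?_, ?_, ?_⟩
  · by_contra hlt
    exact hns (hs.2 n hnN a ha (not_lt.1 hlt))
  · rw [Finset.coe_insert]
    exact insert_subset hnN hs.1
  · intro a ha b hb hab
    rw [Finset.mem_insert] at hb ⊢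
    by_contra hcon
    rw [not_or] at hcon
    rcases hb with rfl | hb
    · exact hmin a ⟨ha, hcon.2⟩ (lt_of_le_of_ne hab hcon.1)
    · exact hcon.2 (hs.2 a ha b hb hab)

/-- The prescriptions `V n` for the good continuations `n` are merged into one by diagonal
intersection. -/
theorem leadsTo_of_eventually {𝓤 : Ultrafilter ℕ+} {𝓕 : Set (Finset ℕ+)} {s : Finset ℕ+}
    (hs : ∀ᶠ n in 𝓤, LeadsTo 𝓤 𝓕 (insert n s)) : LeadsTo 𝓤 𝓕 s := by
  classical
  have hch : ∀ n, ∃ V : Finset ℕ+ → Set ℕ+, (∀ t, V t ∈ 𝓤) ∧ (LeadsTo 𝓤 𝓕 (insert n s) →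
      ∀ N : Set ℕ+, N.Infinite → IsInitial (insert n s) N →
        IsDiagonal V (insert n s) N → ∃ F ∈ 𝓕, IsInitial F N) := by
    intro n
    by_cases h : LeadsTo 𝓤 𝓕 (insert n s)
    · obtain ⟨V, hV, hV'⟩ := h
      exact ⟨V, hV, fun _ => hV'⟩
    · exact ⟨fun _ => univ, fun _ => Filter.univ_mem, fun h' => absurd h' h⟩
  choose V hV hV' using hch
  -- Only the finitely many `n ∈ t` are imposed on `t`. This suffices: once `n` is the next element
  -- of `N` after `s`, every `t ⊇ insert n s` contains it.
  refine ⟨fun t => {n | LeadsTo 𝓤 𝓕 (insert n s)} ∩ {m | ∀ n ∈ t, m ∈ V n t},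
    fun t => Filter.inter_mem hs ((Filter.eventually_all_finset t).2 fun n _ => hV n t), ?_⟩
  intro N hN hsN hdiag
  obtain ⟨n, hnN, hn, hnI⟩ := hsN.exists_next hN
  refine hV' n (hdiag s subset_rfl hsN.1 n hnN hn).1 N hN hnI fun t ht htN m hm hlt => ?_
  exact (hdiag t ((Finset.subset_insert _ _).trans ht) htN m hm hlt).2 n
    (ht (Finset.mem_insert_self _ _))

/-- Diagonal intersections of members of a nonprincipal ultrafilter contain infinite sets. -/
theorem exists_infinite_diagonal (𝓤 : Ultrafilter ℕ+) (hU : (𝓤 : Filter ℕ+) ≤ Filter.cofinite)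
    {L : Set ℕ+} (hL : L ∈ 𝓤) (U : Finset ℕ+ → Set ℕ+) (h : ∀ s, U s ∈ 𝓤) :
    ∃ M : Set ℕ+, M.Infinite ∧ M ⊆ L ∧
      ∀ s : Finset ℕ+, (s : Set ℕ+) ⊆ M → ∀ n ∈ M, (∀ a ∈ s, a < n) → n ∈ U s := by
  -- A nonempty `s` in the range has its maximum among the earlier terms, so it is one of the
  -- finitely many subsets of some `Iic x`. Only `∅` has no such term, so `U ∅` is required from the
  -- start.
  obtain ⟨f, hf, hf'⟩ := exists_seq_of_forall_finset_exists (fun x : ℕ+ => x ∈ L ∩ U ∅)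
    (fun x y => x < y ∧ ∀ s ∈ (Finset.Iic x).powerset, y ∈ U s) (by
      intro t _
      have h1 : {y | y ∈ L ∩ U ∅} ∈ 𝓤 := Filter.inter_mem hL (h ∅)
      have h2 : {y | ∀ x ∈ t, x < y ∧ ∀ s ∈ (Finset.Iic x).powerset, y ∈ U s} ∈ 𝓤 := by
        refine (Filter.eventually_all_finset t).2 fun x _ => Filter.Eventually.and ?_ ?_
        · refine hU ?_
          refine (finite_Iic x).subset fun y hy => ?_
          simpa using hy
        · exact (Filter.eventually_all_finset _).2 fun s _ => h s
      obtain ⟨y, hy1, hy2⟩ := 𝓤.nonempty_of_mem (Filter.inter_mem h1 h2)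
      exact ⟨y, hy1, hy2⟩)
  have hmono : StrictMono f := fun m n hmn => (hf' m n hmn).1
  refine ⟨range f, infinite_range_of_injective hmono.injective, ?_, ?_⟩
  · rintro _ ⟨n, rfl⟩
    exact (hf n).1
  · rintro s hs _ ⟨n, rfl⟩ hlt
    rcases s.eq_empty_or_nonempty with rfl | hne
    · exact (hf n).2
    · obtain ⟨k, hk⟩ := hs (s.max'_mem hne)
      have hkn : k < n := hmono.lt_iff_lt.1 (hk ▸ hlt _ (s.max'_mem hne))
      refine (hf' k n hkn).2 s ?_
      rw [Finset.mem_powerset]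
      intro a ha
      rw [Finset.mem_Iic, hk]
      exact s.le_max' a ha

/-- Galvin's lemma. -/
theorem galvin (𝓕 : Set (Finset ℕ+)) {L : Set ℕ+} (hL : L.Infinite) :
    ∃ M : Set ℕ+, M.Infinite ∧ M ⊆ L ∧ ((∀ F ∈ 𝓕, ¬ (F : Set ℕ+) ⊆ M) ∨
      ∀ N : Set ℕ+, N.Infinite → N ⊆ M → ∃ F ∈ 𝓕, IsInitial F N) := by
  classical
  have : (Filter.cofinite ⊓ Filter.principal L).NeBot := by
    rw [Filter.cofinite_inf_principal_neBot_iff]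
    exact hL
  set 𝓤 := Ultrafilter.of (Filter.cofinite ⊓ Filter.principal L)
  have hle : (𝓤 : Filter ℕ+) ≤ Filter.cofinite ⊓ Filter.principal L := Ultrafilter.of_le _
  have hU : (𝓤 : Filter ℕ+) ≤ Filter.cofinite := hle.trans inf_le_left
  have hLU : L ∈ 𝓤 := Filter.le_principal_iff.1 (hle.trans inf_le_right)
  by_cases h : LeadsTo 𝓤 𝓕 ∅
  · obtain ⟨V, hV, hV'⟩ := h
    obtain ⟨M, hM, hML, hdiag⟩ := exists_infinite_diagonal 𝓤 hU hLU V hV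
    refine ⟨M, hM, hML, Or.inr fun N hN hNM => hV' N hN ⟨by simp, by simp⟩ ?_⟩
    exact fun t _ ht n hn hlt => hdiag t (ht.trans hNM) n (hNM hn) hlt
  · obtain ⟨M, hM, hML, hdiag⟩ := exists_infinite_diagonal 𝓤 hU hLU
      -- If `s` does not lead to `𝓕`, the ultrafilter decides that most one-point extensions do not
      -- either. A diagonal set for these steps therefore has no finite subset that leads to `𝓕`.
      (fun s => {n | ¬ LeadsTo 𝓤 𝓕 s → ¬ LeadsTo 𝓤 𝓕 (insert n s)}) (by
        intro s
        by_cases hs : LeadsTo 𝓤 𝓕 s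
        · exact Filter.mem_of_superset Filter.univ_mem fun n _ h' => absurd hs h'
        · have h1 : ∀ᶠ n in 𝓤, ¬ LeadsTo 𝓤 𝓕 (insert n s) :=
            Ultrafilter.eventually_not.2 fun h' => hs (leadsTo_of_eventually h')
          exact h1.mono fun n hn _ => hn)
    have key : ∀ s : Finset ℕ+, (s : Set ℕ+) ⊆ M → ¬ LeadsTo 𝓤 𝓕 s := by
      intro s
      induction s using Finset.induction_on_max with
      | empty => exact fun _ => h
      | insert a s ha ih =>
        intro hs
        rw [Finset.coe_insert, insert_subset_iff] at hs
        exact hdiag s hs.2 a hs.1 ha (ih hs.2)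
    exact ⟨M, hM, hML, Or.inl fun F hF hFM => key F hFM (leadsTo_of_mem hF)⟩

/-- Gasparis' dichotomy for hereditary families. -/
theorem hereditary_dichotomy {G E : Set (Finset ℕ+)} (hG : IsHereditary G) (hE : IsHereditary E)
    {L : Set ℕ+} (hL : L.Infinite) :
    ∃ M : Set ℕ+, M.Infinite ∧ M ⊆ L ∧
      ((∀ F ∈ G, (F : Set ℕ+) ⊆ M → F ∈ E) ∨ ∀ F ∈ E, (F : Set ℕ+) ⊆ M → F ∈ G) := by
  classical
  obtain ⟨M, hM, hML, h | h⟩ := galvin (G \ E) hL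
  · refine ⟨M, hM, hML, Or.inl fun F hF hFM => ?_⟩
    by_contra hFE
    exact h F ⟨hF, hFE⟩ hFM
  · refine ⟨M, hM, hML, Or.inr fun F hF hFM => ?_⟩
    -- Test the second alternative on `F` followed by the tail of `M`. The initial segment `K ∈ G \
    -- E` is not inside `F`, because `E` is hereditary, so it passes `max F` and contains `F`.
    have hinf : ((F : Set ℕ+) ∪ (M \ Finset.Iic (F.sup id))).Infinite :=
      (hM.sdiff (Finset.finite_toSet _)).mono subset_union_right
    obtain ⟨K, ⟨hKG, hKE⟩, hK, hKi⟩ := h _ hinf (union_subset hFM sdiff_subset)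
    have hKF : ¬ K ⊆ F := fun hsub => hKE (hE F hF K hsub)
    obtain ⟨k, hk, hkF⟩ := Finset.not_subset.1 hKF
    refine hG K hKG F fun a ha => hKi a (Or.inl ha) k hk ?_
    have h2 : k ∉ Finset.Iic (F.sup id) := ((hK hk).resolve_left hkF).2
    rw [Finset.mem_Iic, not_le] at h2
    exact (Finset.le_sup (f := id) ha).trans h2.le

/-! ### Regular families and their derivatives -/

/-- Hereditary and spreading families, in a combinatorial form, that contain no infinite set. -/
structure IsRegularFamily (G : Set (Finset ℕ+)) : Prop where
  empty_mem : ∅ ∈ G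
  hereditary : IsHereditary G
  image_mem : ∀ E ∈ G, ∀ g : ℕ+ → ℕ+, StrictMonoOn g E → (∀ a ∈ E, a ≤ g a) → E.image g ∈ G
  exists_notMem : ∀ N : Set ℕ+, N.Infinite → ∃ F : Finset ℕ+, (F : Set ℕ+) ⊆ N ∧ F ∉ G

theorem IsSpread.exists_strictMonoOn {F E : Finset ℕ+} (h : IsSpread F E) :
    ∃ g : ℕ+ → ℕ+, StrictMonoOn g E ∧ (∀ a ∈ E, a ≤ g a) ∧ E.image g = F := by
  obtain ⟨hc, hle⟩ := h
  let e := E.orderEmbOfFin rfl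
  let f := F.orderEmbOfFin hc
  let g : ℕ+ → ℕ+ := Function.extend e f id
  have hg : ∀ i, g (e i) = f i := fun i => e.injective.extend_apply f id i
  have hE : ∀ a ∈ E, ∃ i, e i = a := fun a ha => by
    have : a ∈ range e := by rw [Finset.range_orderEmbOfFin]; exact ha
    exact this
  refine ⟨g, ?_, ?_, ?_⟩
  · intro a ha b hb hab
    obtain ⟨i, rfl⟩ := hE a ha
    obtain ⟨j, rfl⟩ := hE b hb
    rw [hg, hg]
    exact f.strictMono (e.lt_iff_lt.1 hab)
  · intro a ha
    obtain ⟨i, rfl⟩ := hE a ha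
    rw [hg]
    exact hle i
  · rw [← Finset.image_orderEmbOfFin_univ F hc]
    conv_lhs => rw [← Finset.image_orderEmbOfFin_univ E rfl]
    rw [Finset.image_image]
    exact Finset.image_congr fun i _ => hg i

theorem isClopen_setOf_apply_eq (n : ℕ+) (b : Bool) : IsClopen {x : ℕ+ → Bool | x n = b} :=
  (isClopen_discrete {b}).preimage (continuous_apply n)

theorem isClopen_setOf_eqOn (s : Finset ℕ+) (y : ℕ+ → Bool) :
    IsClopen {x : ℕ+ → Bool | ∀ n ∈ s, x n = y n} := by
  have : {x : ℕ+ → Bool | ∀ n ∈ s, x n = y n} = ⋂ n ∈ s, {x | x n = y n} := by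
    ext; simp
  rw [this]
  exact isClopen_biInter_finset fun n _ => isClopen_setOf_apply_eq n _

theorem toCantor_apply_eq_true {E : Finset ℕ+} {n : ℕ+} : toCantor E n = true ↔ n ∈ E := by
  simp [toCantor]

/-- A point outside the image, whether its support is finite or infinite, contains a finite set `F ∉
G`. By heredity, no member of `G` agrees with it on `F`. -/
theorem IsRegularFamily.isClosed {G : Set (Finset ℕ+)} (hG : IsRegularFamily G) :
    IsClosed (cantorImage G) := by
  rw [← isOpen_compl_iff, isOpen_iff_forall_mem_open]
  intro x hx
  obtain ⟨F, hF, hFG⟩ : ∃ F : Finset ℕ+, (∀ a ∈ F, x a = true) ∧ F ∉ G := by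
    by_cases hfin : {a | x a = true}.Finite
    · refine ⟨hfin.toFinset, by simp, fun h => hx ⟨_, h, ?_⟩⟩
      ext a
      rw [Bool.eq_iff_iff, toCantor_apply_eq_true]
      simp
    · exact hG.exists_notMem _ hfin
  refine ⟨{y | ∀ n ∈ F, y n = x n}, ?_, (isClopen_setOf_eqOn F x).isOpen, fun n _ => rfl⟩
  rintro _ hy ⟨E, hE, rfl⟩
  exact hFG (hG.hereditary E hE F fun a ha =>
    toCantor_apply_eq_true.1 ((hy a ha).trans (hF a ha)))

theorem IsRegularFamily.isRegular {G : Set (Finset ℕ+)} (hG : IsRegularFamily G) :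
    IsRegular G where
  compact := hG.isClosed.isCompact
  hereditary := hG.hereditary
  spreading := by
    intro E hE F hF
    obtain ⟨g, h1, h2, rfl⟩ := hF.exists_strictMonoOn
    exact hG.image_mem E hE g h1 h2

/-- At most the empty set survives in the `α`-th derivative of `G`. -/
def RankLE (G : Set (Finset ℕ+)) (α : Ordinal.{0}) : Prop :=
  iteratedDerivedSet (cantorImage G) α ⊆ {toCantor ∅}

theorem rankLE_iff {G : Set (Finset ℕ+)} {α : Ordinal.{0}} :
    RankLE G α ↔ ∀ x ∈ iteratedDerivedSet (cantorImage G) α, ∀ n, x n ≠ true := by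
  refine forall₂_congr fun x _ => ⟨?_, fun h => ?_⟩
  · rintro rfl n
    simp [toCantor]
  · ext n
    simpa [toCantor] using h n

theorem RankLE.iteratedDerivedSet_eq_empty {G : Set (Finset ℕ+)} {α β : Ordinal.{0}}
    (h : RankLE G α) (hαβ : α < β) : iteratedDerivedSet (cantorImage G) β = ∅ := by
  have h1 : iteratedDerivedSet (cantorImage G) (α + 1) = ∅ :=
    subset_empty_iff.1 ((iteratedDerivedSet_add_subset _ _ _).trans
      (iteratedDerivedSet_one_of_subset_singleton h).subset)
  exact subset_empty_iff.1 ((iteratedDerivedSet_antitone _ (Order.add_one_le_of_lt hαβ)).trans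
    h1.subset)

theorem cbIndex_le {G : Set (Finset ℕ+)} {α : Ordinal.{0}}
    (h : iteratedDerivedSet (cantorImage G) α = ∅) : cbIndex G ≤ (α : WithTop Ordinal.{0}) := by
  rw [cbIndex, if_pos ⟨α, h⟩, WithTop.coe_le_coe]
  exact csInf_le' h

/-! ### Singletons -/

theorem isRegularFamily_card_le_one : IsRegularFamily {E : Finset ℕ+ | E.card ≤ 1} where
  empty_mem := by simp
  hereditary := fun _ hF _ hE => (Finset.card_le_card hE).trans hF
  image_mem := fun _ hE _ _ _ => Finset.card_image_le.trans hE
  exists_notMem := by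
    intro N hN
    obtain ⟨F, hF, hc⟩ := hN.exists_subset_card_eq 2
    exact ⟨F, hF, by simp [hc]⟩

/-- Each `{m}` is isolated: it is the only member containing `m`. -/
theorem rankLE_card_le_one : RankLE {E : Finset ℕ+ | E.card ≤ 1} 1 := by
  rw [rankLE_iff]
  intro x hx m hm
  have h1 := mem_iteratedDerivedSet_inter (isClopen_setOf_apply_eq m true).isOpen hx hm
  rw [iteratedDerivedSet_one_of_subset_singleton (p := toCantor {m})] at h1
  · exact h1
  · rintro _ ⟨⟨E, hE, rfl⟩, hmE⟩
    have hmE' : m ∈ E := toCantor_apply_eq_true.1 hmE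
    rw [mem_singleton_iff, Finset.eq_singleton_iff_unique_mem.2
      ⟨hmE', fun a ha => Finset.card_le_one.1 hE a ha m hmE'⟩]

/-! ### Joins -/

/-- The sets `E ∪ F` with `E ∈ A`, `F ∈ B` and `E < F`. -/
def joinFamily (A B : Set (Finset ℕ+)) : Set (Finset ℕ+) :=
  {K | ∃ E ∈ A, ∃ F ∈ B, (∀ a ∈ E, ∀ b ∈ F, a < b) ∧ K = E ∪ F}

theorem IsRegularFamily.joinFamily {A B : Set (Finset ℕ+)} (hA : IsRegularFamily A)
    (hB : IsRegularFamily B) : IsRegularFamily (joinFamily A B) where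
  empty_mem := ⟨∅, hA.empty_mem, ∅, hB.empty_mem, by simp, by simp⟩
  hereditary := by
    rintro _ ⟨E, hE, F, hF, hlt, rfl⟩ K hK
    refine ⟨K ∩ E, hA.hereditary E hE _ Finset.inter_subset_right, K ∩ F,
      hB.hereditary F hF _ Finset.inter_subset_right, fun a ha b hb =>
        hlt a (Finset.mem_inter.1 ha).2 b (Finset.mem_inter.1 hb).2, ?_⟩
    rw [← Finset.inter_union_distrib_left, Finset.inter_eq_left.2 hK]
  image_mem := by
    rintro _ ⟨E, hE, F, hF, hlt, rfl⟩ g hg hle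
    rw [Finset.coe_union] at hg
    refine ⟨E.image g, hA.image_mem E hE g (hg.mono subset_union_left) fun a ha =>
        hle a (Finset.mem_union_left _ ha),
      F.image g, hB.image_mem F hF g (hg.mono subset_union_right) fun a ha =>
        hle a (Finset.mem_union_right _ ha), ?_, Finset.image_union _ _⟩
    intro _ ha' _ hb'
    obtain ⟨a, ha, rfl⟩ := Finset.mem_image.1 ha'
    obtain ⟨b, hb, rfl⟩ := Finset.mem_image.1 hb'
    exact hg (Or.inl ha) (Or.inr hb) (hlt a ha b hb)
  exists_notMem := by
    intro N hN
    -- If `F ∪ K = E ∪ H` is a splitting, then `F ⊄ E`, so some point of `F` falls in `H`; all of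
    -- `K` comes later and is forced into `H`, although `K ∉ B`.
    obtain ⟨F, hFN, hF⟩ := hA.exists_notMem N hN
    obtain ⟨K, hKN, hK⟩ := hB.exists_notMem (N \ Finset.Iic (F.sup id))
      (hN.sdiff (Finset.finite_toSet _))
    refine ⟨F ∪ K, ?_, ?_⟩
    · rw [Finset.coe_union]
      exact union_subset hFN (hKN.trans sdiff_subset)
    rintro ⟨E, hE, H, hH, hlt, heq⟩
    have hnot : ¬ F ⊆ E := fun h => hF (hA.hereditary E hE F h)
    obtain ⟨f, hf, hfE⟩ := Finset.not_subset.1 hnot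
    have hfH : f ∈ H := by
      have : f ∈ E ∪ H := heq ▸ Finset.mem_union_left _ hf
      exact (Finset.mem_union.1 this).resolve_left hfE
    refine hK (hB.hereditary H hH K fun k hk => ?_)
    have hkf : f < k := by
      have h1 : k ∉ Finset.Iic (F.sup id) := (hKN hk).2
      rw [Finset.mem_Iic, not_le] at h1
      exact (Finset.le_sup (f := id) hf).trans_lt h1
    have hk' : k ∈ E ∪ H := heq ▸ Finset.mem_union_right _ hk
    exact (Finset.mem_union.1 hk').resolve_left fun hkE => (hlt k hkE f hfH).asymm hkf

/-- Removal of `E` in the Cantor space. -/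
def removeSet (E : Finset ℕ+) (x : ℕ+ → Bool) : ℕ+ → Bool := fun n => x n && decide (n ∉ E)

theorem continuous_removeSet (E : Finset ℕ+) : Continuous (removeSet E) :=
  continuous_pi fun n =>
    (continuous_of_discreteTopology (f := fun b : Bool => b && decide (n ∉ E))).comp
      (continuous_apply n)

theorem injOn_removeSet (E : Finset ℕ+) :
    InjOn (removeSet E) {x | ∀ n ∈ E, x n = toCantor E n} := by
  intro x hx y hy hxy
  ext n
  by_cases hn : n ∈ E
  · rw [hx n hn, hy n hn]
  · simpa [removeSet, hn] using congrFun hxy n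

/-- Suppose `H ∉ A` survives. A member `E ∪ F` agreeing with `H` up to `max H` has `E ⊊ H`, so
finitely many `E` occur and `H` survives in the piece of one of them. There, removal of `E` is
continuous and injective into `B`, and would put the nonempty set `H \ E` into the `β`-th derivative
of `B`. -/
theorem iteratedDerivedSet_joinFamily_subset {A B : Set (Finset ℕ+)} (hA : IsRegularFamily A)
    (hB : IsRegularFamily B) {β : Ordinal.{0}} (hβ : RankLE B β) :
    iteratedDerivedSet (cantorImage (joinFamily A B)) β ⊆ cantorImage A := by
  intro x hx
  obtain ⟨H, hH, rfl⟩ := iteratedDerivedSet_subset _ _ hx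
  refine ⟨H, ?_, rfl⟩
  by_contra hHA
  set S : Set (ℕ+ → Bool) := {y | ∀ n ∈ Finset.Iic (H.sup id), y n = toCantor H n}
  let T : Finset ℕ+ → Set (ℕ+ → Bool) := fun E =>
    {y | ∀ n ∈ E, y n = toCantor E n} ∩ removeSet E ⁻¹' cantorImage B
  have hsub : cantorImage (joinFamily A B) ∩ S ⊆ ⋃ E ∈ H.ssubsets, T E := by
    rintro _ ⟨⟨_, ⟨E, hE, F, hF, hlt, rfl⟩, rfl⟩, hy⟩
    have hmem : ∀ n ∈ Finset.Iic (H.sup id), (n ∈ E ∪ F ↔ n ∈ H) := fun n hn => by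
      rw [← toCantor_apply_eq_true, hy n hn, toCantor_apply_eq_true]
    have hHI : H ⊆ Finset.Iic (H.sup id) := fun a ha =>
      Finset.mem_Iic.2 (Finset.le_sup (f := id) ha)
    obtain ⟨h, hh, hhE⟩ := Finset.not_subset.1 fun h => hHA (hA.hereditary E hE H h)
    have hhF : h ∈ F := (Finset.mem_union.1 ((hmem h (hHI hh)).2 hh)).resolve_left hhE
    have hEH : E ⊆ H := fun a ha => (hmem a (Finset.mem_Iic.2
      ((hlt a ha h hhF).le.trans (Finset.mem_Iic.1 (hHI hh))))).1 (Finset.mem_union_left _ ha)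
    refine mem_iUnion₂.2 ⟨E, Finset.mem_ssubsets.2 ⟨hEH, fun h' => hhE (h' hh)⟩, ?_, F, hF, ?_⟩
    · intro n hn
      simp [toCantor, hn]
    · ext n
      have : n ∈ F → n ∉ E := fun h1 h2 => (hlt n h2 n h1).false
      rw [Bool.eq_iff_iff]
      simp only [toCantor, removeSet, Finset.mem_union, Bool.and_eq_true, decide_eq_true_eq]
      tauto
  have h1 := mem_iteratedDerivedSet_inter (isClopen_setOf_eqOn _ _).isOpen hx
    (show toCantor H ∈ S from fun _ _ => rfl)
  have h2 := iteratedDerivedSet_biUnion_subset H.ssubsets (A := T) (fun E _ =>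
    (isClopen_setOf_eqOn _ _).isClosed.inter (hB.isClosed.preimage (continuous_removeSet E))) β
    (iteratedDerivedSet_mono hsub β h1)
  obtain ⟨E, hE, h3⟩ := mem_iUnion₂.1 h2
  have h4 := mapsTo_iteratedDerivedSet (continuous_removeSet E)
    (isClopen_setOf_eqOn E (toCantor E)).isOpen (injOn_removeSet E)
    (A := T E) (B := cantorImage B) (fun y hy => hy.1.2) β
    ⟨h3, (iteratedDerivedSet_subset _ _ h3).1⟩
  obtain ⟨h, hh, hhE⟩ := Finset.exists_of_ssubset (Finset.mem_ssubsets.1 hE)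
  exact rankLE_iff.1 hβ _ h4 h (by simp [removeSet, toCantor, hh, hhE])

/-- The first `β` derivatives use up the later block, leaving a subset of `A`; hence the order of
the sum. -/
theorem RankLE.joinFamily {A B : Set (Finset ℕ+)} (hA : IsRegularFamily A)
    (hB : IsRegularFamily B) {α β : Ordinal.{0}} (hα : RankLE A α) (hβ : RankLE B β) :
    RankLE (joinFamily A B) (β + α) :=
  (iteratedDerivedSet_add_subset _ _ _).trans
    ((iteratedDerivedSet_mono (iteratedDerivedSet_joinFamily_subset hA hB hβ) α).trans hα)

/-- The unions of `n` successive members of `S`. -/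
def blockUnions (S : Set (Finset ℕ+)) : ℕ → Set (Finset ℕ+)
  | 0 => {∅}
  | n + 1 => joinFamily S (blockUnions S n)

theorem IsRegularFamily.blockUnions {S : Set (Finset ℕ+)} (hS : IsRegularFamily S) (n : ℕ) :
    IsRegularFamily (blockUnions S n) := by
  induction n with
  | zero =>
    refine ⟨rfl, ?_, ?_, ?_⟩
    · rintro _ rfl E hE
      exact Finset.subset_empty.1 hE
    · rintro _ rfl g _ _
      exact Finset.image_empty g
    · intro N hN
      obtain ⟨a, ha⟩ := hN.nonempty
      exact ⟨{a}, by simpa using ha, Finset.singleton_ne_empty a⟩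
  | succ n ih => exact hS.joinFamily ih

theorem RankLE.blockUnions {S : Set (Finset ℕ+)} (hS : IsRegularFamily S) {α : Ordinal.{0}}
    (hα : RankLE S α) (n : ℕ) : RankLE (blockUnions S n) (α * n) := by
  induction n with
  | zero =>
    refine (iteratedDerivedSet_subset _ _).trans ?_
    rintro _ ⟨_, rfl, rfl⟩
    rfl
  | succ n ih =>
    rw [Nat.cast_add_one, mul_add_one]
    exact RankLE.joinFamily hS (hS.blockUnions n) hα ih

/-! ### Diagonal unions -/

/-- The sets `E` that belong to `H n` for some `n ≤ E`. -/
def diagonalUnion (H : ℕ+ → Set (Finset ℕ+)) : Set (Finset ℕ+) :=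
  {E | ∃ n, (∀ a ∈ E, n ≤ a) ∧ E ∈ H n}

theorem IsRegularFamily.diagonalUnion {H : ℕ+ → Set (Finset ℕ+)}
    (hH : ∀ n, IsRegularFamily (H n)) : IsRegularFamily (diagonalUnion H) where
  empty_mem := ⟨1, by simp, (hH 1).empty_mem⟩
  hereditary := by
    rintro F ⟨n, hn, hF⟩ E hE
    exact ⟨n, fun a ha => hn a (hE ha), (hH n).hereditary F hF E hE⟩
  image_mem := by
    rintro E ⟨n, hn, hE⟩ g hg hle
    refine ⟨n, fun b hb => ?_, (hH n).image_mem E hE g hg hle⟩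
    obtain ⟨a, ha, rfl⟩ := Finset.mem_image.1 hb
    exact (hn a ha).trans (hle a ha)
  exists_notMem := by
    intro N hN
    obtain ⟨m, hm⟩ := hN.nonempty
    choose F hFN hF using fun n => (hH n).exists_notMem N hN
    -- The point `m` restricts the index to `n ≤ m`, and a set outside each of these `H n` is
    -- included.
    refine ⟨insert m ((Finset.Iic m).biUnion F), ?_, ?_⟩
    · rw [Finset.coe_insert, Finset.coe_biUnion]
      exact insert_subset hm (iUnion₂_subset fun n _ => hFN n)
    · rintro ⟨n, hn, h⟩
      refine hF n ((hH n).hereditary _ h _ ((Finset.subset_biUnion_of_mem F ?_).trans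
        (Finset.subset_insert _ _)))
      exact Finset.mem_Iic.2 (hn m (Finset.mem_insert_self _ _))

/-- Near a set containing `m`, only the finitely many `H n` with `n ≤ m` contribute. -/
theorem RankLE.diagonalUnion {H : ℕ+ → Set (Finset ℕ+)} (hH : ∀ n, IsRegularFamily (H n))
    {α : Ordinal.{0}} (hα : ∀ n, iteratedDerivedSet (cantorImage (H n)) α = ∅) :
    RankLE (diagonalUnion H) α := by
  rw [rankLE_iff]
  intro x hx m hm
  have h1 := mem_iteratedDerivedSet_inter (isClopen_setOf_apply_eq m true).isOpen hx hm
  have hsub : cantorImage (ProbBlock.diagonalUnion H) ∩ {x | x m = true} ⊆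
      ⋃ n ∈ Finset.Iic m, cantorImage (H n) := by
    rintro _ ⟨⟨E, ⟨n, hn, hE⟩, rfl⟩, hmE⟩
    exact mem_iUnion₂.2 ⟨n, Finset.mem_Iic.2 (hn m (toCantor_apply_eq_true.1 hmE)), E, hE, rfl⟩
  have h2 := iteratedDerivedSet_biUnion_subset (Finset.Iic m) (fun n _ => (hH n).isClosed) α
    (iteratedDerivedSet_mono hsub α h1)
  simp [hα] at h2

/-! ### Schreier families -/

theorem biUnion_mem_blockUnions {S : Set (Finset ℕ+)} {k : ℕ} (F : Fin k → Finset ℕ+)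
    (hF : ∀ i, F i ∈ S) (hlt : ∀ i j, i < j → ∀ a ∈ F i, ∀ b ∈ F j, a < b) :
    Finset.univ.biUnion F ∈ blockUnions S k := by
  induction k with
  | zero => exact Finset.biUnion_empty
  | succ k ih =>
    refine ⟨F 0, hF 0, Finset.univ.biUnion fun i : Fin k => F i.succ,
      ih _ (fun i => hF _) (fun i j hij => hlt _ _ (Fin.succ_lt_succ_iff.2 hij)), ?_, ?_⟩
    · intro a ha b hb
      obtain ⟨i, -, hi⟩ := Finset.mem_biUnion.1 hb
      exact hlt 0 i.succ (Fin.succ_pos i) a ha b hi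
    · ext a
      simp [Fin.exists_fin_succ]

/-- Empty blocks are allowed in `blockUnions` but not in `schreierSucc`; dropping them can only
lower the number of blocks. -/
theorem exists_biUnion_of_mem_blockUnions {S : Set (Finset ℕ+)} {n : ℕ} {E : Finset ℕ+}
    (hE : E ∈ blockUnions S n) : ∃ k ≤ n, ∃ F : Fin k → Finset ℕ+,
      (∀ i, (F i).Nonempty ∧ F i ∈ S) ∧ (∀ i j, i < j → ∀ a ∈ F i, ∀ b ∈ F j, a < b) ∧
      E = Finset.univ.biUnion F := by
  induction n generalizing E with
  | zero => exact ⟨0, le_rfl, fun _ => ∅, fun i => i.elim0, fun i => i.elim0, hE⟩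
  | succ n ih =>
    obtain ⟨A, hA, B, hB, hAB, rfl⟩ := hE
    obtain ⟨k, hk, F, hF, hlt, rfl⟩ := ih hB
    rcases A.eq_empty_or_nonempty with rfl | hne
    · exact ⟨k, hk.trans n.le_succ, F, hF, hlt, Finset.empty_union _⟩
    · refine ⟨k + 1, Nat.succ_le_succ hk, Fin.cons A F, ?_, ?_, ?_⟩
      · intro i
        cases i using Fin.cases with
        | zero => exact ⟨hne, hA⟩
        | succ i => exact hF i
      · intro i j hij a ha b hb
        cases j using Fin.cases with
        | zero => exact absurd hij (Fin.not_lt_zero i)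
        | succ j =>
          cases i using Fin.cases with
          | zero => exact hAB a ha b (Finset.mem_biUnion.2 ⟨j, Finset.mem_univ j, hb⟩)
          | succ i => exact hlt i j (Fin.succ_lt_succ_iff.1 hij) a ha b hb
      · ext a
        simp [Fin.exists_fin_succ]

theorem schreierSucc_eq {S : Set (Finset ℕ+)} (hS : IsRegularFamily S) :
    schreierSucc S = diagonalUnion fun n => blockUnions S n := by
  ext E
  constructor
  · rintro (rfl | ⟨n, F, hF, hn, hlt, rfl⟩)
    · exact ⟨1, by simp, (hS.blockUnions _).empty_mem⟩
    · refine ⟨n, fun a ha => ?_, biUnion_mem_blockUnions F (fun i => (hF i).2) hlt⟩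
      obtain ⟨i, -, hi⟩ := Finset.mem_biUnion.1 ha
      exact hn i a hi
  · rintro ⟨n, hn, hE⟩
    obtain ⟨k, hk, F, hF, hlt, rfl⟩ := exists_biUnion_of_mem_blockUnions hE
    rcases Nat.eq_zero_or_pos k with rfl | hk0
    · exact Or.inl Finset.biUnion_empty
    · refine Or.inr ⟨⟨k, hk0⟩, F, hF, fun i a ha => ?_, hlt, rfl⟩
      exact (show (⟨k, hk0⟩ : ℕ+) ≤ n from hk).trans
        (hn a (Finset.mem_biUnion.2 ⟨i, Finset.mem_univ i, ha⟩))

theorem schreier_zero (c : Ordinal.{0} → ℕ+ → Ordinal.{0}) :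
    schreier c 0 = {E | E.card ≤ 1} := by
  simp [schreier]

theorem schreier_add_one (c : Ordinal.{0} → ℕ+ → Ordinal.{0}) (ξ : Ordinal.{0}) :
    schreier c (ξ + 1) = schreierSucc (schreier c ξ) := by
  simp [schreier]

theorem schreier_limit {c : Ordinal.{0} → ℕ+ → Ordinal.{0}} {ξ : Ordinal.{0}}
    (hξ : Order.IsSuccLimit ξ) (hc : ∀ n, c ξ n < ξ) :
    schreier c ξ = diagonalUnion fun n => schreier c (c ξ n + 1) := by
  have h : ∀ n, c ξ n + 1 < ξ := fun n => hξ.add_one_lt (hc n)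
  ext E
  rw [schreier, Ordinal.limitRecOn_limit _ _ _ _ hξ]
  simp only [diagonalUnion, mem_ofPred_eq, exists_prop_of_true (h _)]
  rfl

/-- For `ξ ≠ 0` the Schreier family `S_ξ` is a diagonal union of regular families of index at most
`ω ^ ξ`. -/
theorem schreier_eq_diagonalUnion {c : Ordinal.{0} → ℕ+ → Ordinal.{0}}
    (hc : IsFundamentalChoice c) {ξ : Ordinal.{0}} (hξ : ξ < ω₁) (h0 : ξ ≠ 0)
    (ih : ∀ ζ < ξ, IsRegularFamily (schreier c ζ) ∧ RankLE (schreier c ζ) (ω ^ ζ)) :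
    ∃ H : ℕ+ → Set (Finset ℕ+), (∀ n, IsRegularFamily (H n)) ∧
      (∀ n, iteratedDerivedSet (cantorImage (H n)) (ω ^ ξ) = ∅) ∧
      schreier c ξ = diagonalUnion H := by
  induction ξ using Ordinal.limitRecOn with
  | zero => exact absurd rfl h0
  | add_one ζ _ =>
    obtain ⟨h1, h2⟩ := ih ζ (lt_add_one ζ)
    refine ⟨fun n => blockUnions (schreier c ζ) n, fun n => h1.blockUnions n, fun n => ?_, ?_⟩
    -- The strict inequality `ω ^ ζ * n < ω ^ (ζ + 1)` leaves room for the extra derivative that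
    -- removes `∅`.
    · refine (RankLE.blockUnions h1 h2 n).iteratedDerivedSet_eq_empty ?_
      exact Ordinal.opow_mul_lt_opow (Ordinal.natCast_lt_omega0 _) (lt_add_one ζ)
    · rw [schreier_add_one, schreierSucc_eq h1]
  | limit ξ hlim _ =>
    have hlt := (hc ξ hξ hlim).2.1
    have hlt' : ∀ n, c ξ n + 1 < ξ := fun n => hlim.add_one_lt (hlt n)
    refine ⟨_, fun n => (ih _ (hlt' n)).1, fun n => ?_, schreier_limit hlim hlt⟩
    exact (ih _ (hlt' n)).2.iteratedDerivedSet_eq_empty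
      ((Ordinal.opow_lt_opow_iff_right Ordinal.one_lt_omega0).2 (hlt' n))

theorem isRegularFamily_schreier {c : Ordinal.{0} → ℕ+ → Ordinal.{0}}
    (hc : IsFundamentalChoice c) (ξ : Ordinal.{0}) (hξ : ξ < ω₁) :
    IsRegularFamily (schreier c ξ) ∧ RankLE (schreier c ξ) (ω ^ ξ) := by
  induction ξ using WellFoundedLT.induction with
  | ind ξ ih =>
    by_cases h0 : ξ = 0
    · subst h0
      rw [schreier_zero, Ordinal.opow_zero]
      exact ⟨isRegularFamily_card_le_one, rankLE_card_le_one⟩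
    · obtain ⟨H, h1, h2, h3⟩ := schreier_eq_diagonalUnion hc hξ h0
        fun ζ hζ => ih ζ hζ (hζ.trans hξ)
      rw [h3]
      exact ⟨IsRegularFamily.diagonalUnion h1, RankLE.diagonalUnion h1 h2⟩

/-! ### Fullness -/

/-- A hereditary family that contains the members of each `H n` inside some infinite subset of each
infinite `L' ⊆ L` contains a copy of the diagonal union. -/
theorem exists_map_mem_of_diagonalUnion {H : ℕ+ → Set (Finset ℕ+)}
    (hH : ∀ n, IsRegularFamily (H n)) {E : Set (Finset ℕ+)} {L : Set ℕ+} (hL : L.Infinite)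
    (h : ∀ n, ∀ L' : Set ℕ+, L'.Infinite → L' ⊆ L → ∃ M : Set ℕ+, M.Infinite ∧ M ⊆ L' ∧
      ∀ F ∈ H n, (F : Set ℕ+) ⊆ M → F ∈ E) :
    ∃ m : ℕ+ ↪o ℕ+, ∀ F ∈ diagonalUnion H, F.map m.toEmbedding ∈ E := by
  have hstep : ∀ n : ℕ+, ∀ L' : {L' : Set ℕ+ // L'.Infinite ∧ L' ⊆ L},
      ∃ M : {L' : Set ℕ+ // L'.Infinite ∧ L' ⊆ L}, M.1 ⊆ L'.1 ∧
        ∀ F ∈ H n, (F : Set ℕ+) ⊆ M.1 → F ∈ E := fun n L' => by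
    obtain ⟨M, h1, h2, h3⟩ := h n L'.1 L'.2.1 L'.2.2
    exact ⟨⟨M, h1, h2.trans L'.2.2⟩, h2, h3⟩
  choose next hnext hnext' using hstep
  -- The sets decrease from `M 0 = L`, and `M k` for `k ≥ 1` handles `H k`.
  let M : ℕ → {L' : Set ℕ+ // L'.Infinite ∧ L' ⊆ L} := fun k =>
    Nat.rec ⟨L, hL, subset_rfl⟩ (fun k M => next k.succPNat M) k
  have hanti : Antitone fun k => (M k).1 := antitone_nat_of_succ_le fun k => hnext k.succPNat (M k)
  obtain ⟨φ, hφ, hφM⟩ := Filter.extraction_forall_of_frequently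
    (P := fun k j => j.succPNat ∈ (M (k + 1)).1) (by
      intro k
      rw [Nat.frequently_atTop_iff_infinite]
      have h1 := (M (k + 1)).2.1
      exact h1.preimage (f := Nat.succPNat) fun x _ => ⟨x.natPred, x.succPNat_natPred⟩)
  refine ⟨OrderEmbedding.ofStrictMono (fun n => (φ n.natPred).succPNat) ?_, ?_⟩
  · intro a b hab
    exact Nat.succPNat_lt_succPNat.2 (hφ (PNat.natPred_lt_natPred.2 hab))
  · rintro F ⟨n, hn, hF⟩
    set m : ℕ+ ↪o ℕ+ := OrderEmbedding.ofStrictMono (fun n => (φ n.natPred).succPNat) _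
    have h1 : F.map m.toEmbedding ∈ H n := by
      rw [Finset.map_eq_image]
      exact (hH n).image_mem F hF m (m.strictMono.strictMonoOn _) fun a _ =>
        m.strictMono.le_apply
    have h2 := hnext' n.natPred.succPNat (M n.natPred) (F.map m.toEmbedding)
    rw [PNat.succPNat_natPred] at h2
    refine h2 h1 ?_
    rintro _ hx
    obtain ⟨a, ha, rfl⟩ := Finset.mem_map.1 hx
    -- The `a`-th chosen point lies in `M a`, hence in `M n` because `n ≤ a`.
    have h3 := hanti (Nat.succ_le_succ (PNat.natPred_le_natPred.2 (hn a ha))) (hφM a.natPred)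
    change _ ∈ (next n.natPred.succPNat (M n.natPred)).1 at h3
    rwa [PNat.succPNat_natPred] at h3

/-! ### Large sets and the regulatory property -/

theorem isHereditary_largeSets (𝒬 : Set (Finset ℕ+)) (f : ℕ+ → maxMembers 𝒬 → ℝ)
    (M : InfSubset) (δ : ℝ) : IsHereditary (largeSets 𝒬 f M δ) := by
  rintro F ⟨hF, K, hK, h⟩ E hE
  exact ⟨(Finset.coe_subset.2 hE).trans hF, K, hK, fun i hi => h i (hE hi)⟩

/-- A finitely supported average of at least `ε` of a function bounded by `C` gives mass at least
`(ε - δ) / (C - δ)` to the set where the function is at least `δ`. -/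
theorem le_mul_sum_filter {p : PMF ℕ+} {F : Finset ℕ+} (hF : p.support = F) {u : ℕ+ → ℝ} {C : ℝ}
    (hu : ∀ i, u i ≤ C) {δ ε : ℝ} (hε : ε ≤ ∑' i, (p i).toReal * u i) :
    ε - δ ≤ (C - δ) * ∑ i ∈ F with δ ≤ u i, (p i).toReal := by
  have hzero : ∀ i ∉ F, p i = 0 := fun i hi => by
    rw [PMF.apply_eq_zero_iff, hF]
    exact hi
  have hsum : ∑ i ∈ F, (p i).toReal = 1 := by
    rw [← ENNReal.toReal_sum fun i _ => p.apply_ne_top i, ← tsum_eq_sum (L := .unconditional ℕ+) hzero,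
      p.tsum_coe, ENNReal.toReal_one]
  rw [tsum_eq_sum (s := F) fun i hi => by simp [hzero i hi]] at hε
  calc ε - δ ≤ ∑ i ∈ F, (p i).toReal * (u i - δ) := by
        simp only [mul_sub, Finset.sum_sub_distrib, ← Finset.sum_mul, hsum]
        linarith
    _ ≤ ∑ i ∈ F, if δ ≤ u i then (C - δ) * (p i).toReal else 0 := by
        refine Finset.sum_le_sum fun i _ => ?_
        have h0 : 0 ≤ (p i).toReal := ENNReal.toReal_nonneg
        split_ifs with h
        · nlinarith [hu i]
        · exact mul_nonpos_of_nonneg_of_nonpos h0 (by linarith)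
    _ = (C - δ) * ∑ i ∈ F with δ ≤ u i, (p i).toReal := by
        rw [← Finset.sum_filter, Finset.mul_sum]

/-- Inside every infinite subset of `L` there are large sets of probability bounded below. -/
theorem exists_mem_largeSets {P : InfSubset → ℕ+ → PMF ℕ+} {𝒬 : Set (Finset ℕ+)}
    (hP : IsProbabilityBlock P 𝒬) {f : ℕ+ → maxMembers 𝒬 → ℝ} {C : ℝ} (hC : ∀ i F, |f i F| ≤ C)
    {δ ε : ℝ} {L : InfSubset} {N : InfSubset} (hNL : (N : Set ℕ+) ⊆ L)
    (hN : N ∈ largeAverage P 𝒬 f ε) :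
    ∃ E ∈ largeSets 𝒬 f L δ, (E : Set ℕ+) ⊆ N ∧
      ε - δ ≤ (C - δ) * ∑ i ∈ E, (P N 1 i).toReal := by
  obtain ⟨F, hF, hε⟩ := hN
  obtain ⟨F', -, hF', hsupp⟩ := hP.support_one N
  have hFN : ((F : Finset ℕ+) : Set ℕ+) ⊆ N := by
    rw [← hF, hsupp]
    exact hF'.2.1
  have hsub : (((F : Finset ℕ+).filter fun i => δ ≤ f i F : Finset ℕ+) : Set ℕ+) ⊆ N :=
    (Finset.coe_subset.2 (Finset.filter_subset _ _)).trans hFN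
  exact ⟨_, ⟨hsub.trans hNL, F, hFN.trans hNL, fun i hi => (Finset.mem_filter.1 hi).2⟩, hsub,
    le_mul_sum_filter hF (fun i => (le_abs_self _).trans (hC i F)) hε⟩

/-- A regular family of index at most `ω ^ ξ` cannot contain all large sets inside an infinite
subset of `L`. -/
theorem exists_mem_largeSets_notMem {P : InfSubset → ℕ+ → PMF ℕ+} {𝒬 : Set (Finset ℕ+)}
    (hP : IsProbabilityBlock P 𝒬) {ξ : Ordinal.{0}} (hsuff : IsSufficient P ξ)
    {f : ℕ+ → maxMembers 𝒬 → ℝ} (hf : ∃ C : ℝ, ∀ i F, |f i F| ≤ C) {δ ε : ℝ} (hδ : δ < ε)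
    {L : InfSubset} (hL : ∀ M : InfSubset, (M : Set ℕ+) ⊆ L → M ∈ largeAverage P 𝒬 f ε)
    {G : Set (Finset ℕ+)} (hG : IsRegular G)
    (hcb : cbIndex G ≤ ((ω ^ ξ : Ordinal.{0}) : WithTop Ordinal.{0}))
    {M : InfSubset} (hML : (M : Set ℕ+) ⊆ L) :
    ∃ E ∈ largeSets 𝒬 f L δ, (E : Set ℕ+) ⊆ M ∧ E ∉ G := by
  obtain ⟨C, hC⟩ := hf
  -- `D` is positive and at least `C - δ` whatever the sign of the latter; the factor `2` below
  -- makes the final inequality strict.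
  set D := |C - δ| + 1
  have hD : 0 < D := by positivity
  obtain ⟨N, hNM, hN⟩ := hsuff ((ε - δ) / (2 * D)) (div_pos (by linarith) (by linarith)) G hG hcb M
  obtain ⟨E, hE, hEN, hle⟩ := exists_mem_largeSets hP hC (δ := δ) (hNM.trans hML)
    (hL N (hNM.trans hML))
  refine ⟨E, hE, hEN.trans hNM, fun hEG => ?_⟩
  have h1 := hN N subset_rfl E hEG
  have h0 : 0 ≤ ∑ i ∈ E, (P N 1 i).toReal := Finset.sum_nonneg fun _ _ => ENNReal.toReal_nonneg
  have h2 : (C - δ) * ∑ i ∈ E, (P N 1 i).toReal ≤ D * ((ε - δ) / (2 * D)) :=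
    mul_le_mul (by linarith [le_abs_self (C - δ)]) h1 h0 hD.le
  have h3 : D * ((ε - δ) / (2 * D)) = (ε - δ) / 2 := by field_simp
  linarith

/-- If every infinite subset of `L` contains a nonempty member of `E`, then `E` contains infinitely
many singletons from every infinite subset of `L`. -/
theorem exists_infinite_singleton_mem {E : Set (Finset ℕ+)} (hE : IsHereditary E) {L : Set ℕ+}
    (h : ∀ N : Set ℕ+, N.Infinite → N ⊆ L → ∃ F ∈ E, (F : Set ℕ+) ⊆ N ∧ F.Nonempty) {L' : Set ℕ+}
    (hL' : L'.Infinite) (hLL' : L' ⊆ L) :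
    ∃ M : Set ℕ+, M.Infinite ∧ M ⊆ L' ∧ ∀ i ∈ M, {i} ∈ E := by
  -- Were these points finite in number, deleting them from `L'` would leave no nonempty member of
  -- `E`.
  refine ⟨{i | i ∈ L' ∧ {i} ∈ E}, fun hfin => ?_, fun i hi => hi.1, fun i hi => hi.2⟩
  obtain ⟨F, hF, hFN, i, hi⟩ := h _ (hL'.sdiff hfin) (sdiff_subset.trans hLL')
  exact (hFN hi).2 ⟨(hFN hi).1, hE F hF _ (Finset.singleton_subset_iff.2 hi)⟩

theorem isRegulatory_of_isSufficient {c : Ordinal.{0} → ℕ+ → Ordinal.{0}}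
    (hc : IsFundamentalChoice c) {ξ : Ordinal.{0}} (hξ : ξ < ω₁)
    {P : InfSubset → ℕ+ → PMF ℕ+} {𝒬 : Set (Finset ℕ+)} (hP : IsProbabilityBlock P 𝒬)
    (hsuff : IsSufficient P ξ) : IsRegulatory c P 𝒬 ξ := by
  intro f hf δ ε hδ L hL
  have hher := isHereditary_largeSets 𝒬 f L δ
  have hnot : ∀ G : Set (Finset ℕ+), IsRegularFamily G →
      iteratedDerivedSet (cantorImage G) (ω ^ ξ) = ∅ → ∀ M : Set ℕ+, M.Infinite → M ⊆ L →
      ∃ E ∈ largeSets 𝒬 f L δ, (E : Set ℕ+) ⊆ M ∧ E ∉ G := fun G hG hcb M hM hML =>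
    exists_mem_largeSets_notMem hP hsuff hf hδ hL hG.isRegular (cbIndex_le hcb) (M := ⟨M, hM⟩) hML
  by_cases h0 : ξ = 0
  · subst h0
    have hS := isRegularFamily_card_le_one
    -- The singletons have index `2`, too large for `ω ^ 0 = 1`. The family `{∅}` is used instead:
    -- being outside it means being nonempty.
    have hcb : iteratedDerivedSet (cantorImage (blockUnions {E : Finset ℕ+ | E.card ≤ 1} 0))
        (ω ^ (0 : Ordinal.{0})) = ∅ :=
      (rankLE_card_le_one.blockUnions hS 0).iteratedDerivedSet_eq_empty (by simp)
    obtain ⟨m, hm⟩ := exists_map_mem_of_diagonalUnion (H := fun _ => {E : Finset ℕ+ | E.card ≤ 1})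
      (fun _ => hS) L.2 fun _ L' hL' hLL' => by
        obtain ⟨M, hM, hML, h⟩ := exists_infinite_singleton_mem hher (L := L)
          (fun N hN hNL => by
            obtain ⟨E, hE, hEN, hne⟩ := hnot _ (hS.blockUnions 0) hcb N hN hNL
            exact ⟨E, hE, hEN, Finset.nonempty_iff_ne_empty.2 hne⟩) hL' hLL'
        refine ⟨M, hM, hML, fun F hF hFM => ?_⟩
        rcases F.eq_empty_or_nonempty with rfl | ⟨i, hi⟩
        · obtain ⟨i, hi⟩ := hM.nonempty
          exact hher _ (h i hi) ∅ (Finset.empty_subset _)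
        · rw [Finset.eq_singleton_iff_unique_mem.2
            ⟨hi, fun a ha => Finset.card_le_one.1 hF a ha i hi⟩]
          exact h i (hFM hi)
    refine ⟨m, fun E hE => hm E ⟨1, fun a _ => one_le, ?_⟩⟩
    rwa [schreier_zero] at hE
  · obtain ⟨H, hH, hcb, heq⟩ := schreier_eq_diagonalUnion hc hξ h0
      fun ζ hζ => isRegularFamily_schreier hc ζ (hζ.trans hξ)
    rw [IsFull, heq]
    refine exists_map_mem_of_diagonalUnion hH L.2 fun n L' hL' hLL' => ?_
    obtain ⟨M, hM, hML, h | h⟩ := hereditary_dichotomy (hH n).hereditary hher hL'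
    · exact ⟨M, hM, hML, h⟩
    · obtain ⟨E, hE, hEM, hEG⟩ := hnot (H n) (hH n) (hcb n) M hM (hML.trans hLL')
      exact absurd (h E hE hEM) hEG

end ProbBlock

theorem mainTheorem5 (c : Ordinal.{0} → ℕ+ → Ordinal.{0}) (hc : ProbBlock.IsFundamentalChoice c)
    (ξ : Ordinal.{0}) (hξ : ξ < Ordinal.omega 1)
    (P : ProbBlock.InfSubset → ℕ+ → PMF ℕ+) (𝒬 : Set (Finset ℕ+))
    (hP : ProbBlock.IsProbabilityBlock P 𝒬)
    (hsuff : ProbBlock.IsSufficient P ξ) :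
    ProbBlock.IsRegulatory c P 𝒬 ξ :=
  ProbBlock.isRegulatory_of_isSufficient hc hξ hP hsuff
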